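/- Let $n\ge 2$, and let $\mathbb{H}^{n+1}=\{x\in\mathbb{R}^{1,n+1}:\langle x,x\rangle=-1,\ x_0>0\}$ be the hyperboloid model of hyperbolic space, where $\langle x,y\rangle=-x_0y_0+\sum_{i=1}^{n+1}x_iy_i$. Let $M^n$ be a connected, compact smooth manifold without boundary, let $\phi:M^n\to\mathbb{H}^{n+1}$ be a smooth immersion, and let $\eta:M^n\to\mathbb{R}^{1,n+1}$ be a smooth unit normal field along $\phi$ in $\mathbb{H}^{n+1}$. For $p\in M^n$ let $\mathcal{H}_p$ be the horosphere through $\phi(p)$ whose inward unit normal at $\phi(p)$ is $\eta(p)$, that is, $\mathcal{H}_p=\{x\in\mathbb{H}^{n+1}:\langle x,\phi(p)+\eta(p)\rangle=-1\}$. Suppose that $\phi$ is horospherically convex with respect to $\eta$: for every $p\in M^n$, there is a neighborhood $V$ of $p$ such that $\phi(V\setminus\{p\})\cap\mathcal{H}_p=\emptyset$, and the hyperbolic distance from $\phi$ to $\mathcal{H}_p$ does not vanish up to second order at $p$ in any direction, i.e. for every smooth curve $\gamma$ in $M^n$ with $\gamma(0)=p$ and $\gamma'(0)\ne 0$, $\mathrm{dist}_{\mathbb{H}^{n+1}}(\phi(\gamma(s)),\mathcal{H}_p)$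 is not $o(s^2)$ as $s\to 0$. Then there is $t_0\in\mathbb{R}$ such that for every $t\ge t_0$ the leaf $$\phi_t=\exp_{\phi}(t\eta)=\phi\cosh t+\eta\sinh t:\ M^n\to\mathbb{H}^{n+1}$$ of the normal flow is an embedded sphere: $\phi_t$ is a smooth embedding, and $M^n$ is diffeomorphic to the standard sphere $\mathbb{S}^n$. -/

import Mathlib

open scoped Manifold ContDiff Topology

noncomputable section

/-- The vector space `ℝ^{n+2}` underlying Minkowski spacetime `ℝ^{1,n+1}`. Its Euclidean norm is used
only for its topology and smooth structure; the geometry comes from `minkowskiForm`. -/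
abbrev Minkowski (n : ℕ) : Type := EuclideanSpace ℝ (Fin (n + 2))

/-- The Minkowski form `⟨x, y⟩ = -x₀ y₀ + x₁ y₁ + ⋯ + x_{n+1} y_{n+1}`. -/
def minkowskiForm {n : ℕ} (x y : Minkowski n) : ℝ :=
  -(x 0 * y 0) + ∑ i : Fin (n + 1), x i.succ * y i.succ

/-- Hyperbolic space `ℍ^{n+1} = {x : ⟨x, x⟩ = -1, x₀ > 0}` (hyperboloid model). -/
def hyperbolicSpace (n : ℕ) : Set (Minkowski n) :=
  {x | minkowskiForm x x = -1 ∧ 0 < x 0}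

/-- The hyperbolic distance, `cosh d(x, y) = -⟨x, y⟩` for `x, y ∈ ℍ^{n+1}`. -/
def hyperbolicDist {n : ℕ} (x y : Minkowski n) : ℝ :=
  Real.arcosh (-minkowskiForm x y)

/-- For `ν` in the positive null cone, the horosphere `{x ∈ ℍ^{n+1} : ⟨x, ν⟩ = -1}`, the intersection
of `ℍ^{n+1}` with an affine null hyperplane. Its point at infinity is the ray spanned by `ν`, and its
inward unit normal (pointing to that point at infinity) at `x` is `ν - x`. Every horosphere is of this
form for exactly one `ν`. -/
def horosphere {n : ℕ} (ν : Minkowski n) : Set (Minkowski n) :=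
  {x | x ∈ hyperbolicSpace n ∧ minkowskiForm x ν = -1}

/-- The hyperbolic distance from `x` to the horosphere determined by `ν`. -/
def distToHorosphere {n : ℕ} (ν x : Minkowski n) : ℝ :=
  ⨅ y : horosphere ν, hyperbolicDist x (y : Minkowski n)

section Hypersurface

variable {n : ℕ} {M : Type*} [TopologicalSpace M] [ChartedSpace (EuclideanSpace ℝ (Fin n)) M]

/-- `φ : M^n → ℍ^{n+1}` is a smooth immersion: smooth with values in `ℍ^{n+1} ⊂ ℝ^{1,n+1}`, and with
injective differential at every point. -/
structure IsImmersedHypersurface (φ : M → Minkowski n) : Prop where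
  mem_hyperbolicSpace : ∀ p, φ p ∈ hyperbolicSpace n
  contMDiff : ContMDiff (𝓡 n) 𝓘(ℝ, Minkowski n) ∞ φ
  injective_mfderiv : ∀ p, Function.Injective (mfderiv (𝓡 n) 𝓘(ℝ, Minkowski n) φ p)

/-- `η` is an orientation of the hypersurface `φ`, i.e. a smooth unit normal field: `η(p)` is a unit
spacelike vector, tangent to `ℍ^{n+1}` at `φ(p)`, and orthogonal to the image of `dφ_p`. -/
structure IsUnitNormal (φ η : M → Minkowski n) : Prop where
  contMDiff : ContMDiff (𝓡 n) 𝓘(ℝ, Minkowski n) ∞ η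
  unit : ∀ p, minkowskiForm (η p) (η p) = 1
  tangent : ∀ p, minkowskiForm (η p) (φ p) = 0
  normal : ∀ (p : M) (v : TangentSpace (𝓡 n) p),
    minkowskiForm (η p) (mfderiv (𝓡 n) 𝓘(ℝ, Minkowski n) φ p v : Minkowski n) = 0

/-- The hypersurface `φ` with unit normal field `η` is horospherically convex at `p`. The horosphere
through `φ(p)` whose inward unit normal there is `η(p)` is `horosphere (φ p + η p)`. It is required
that the hypersurface meets this horosphere near `p` only at `p`, and that the distance to the
horosphere does not vanish up to second order at `p` in any direction, i.e. it is not `o(s²)` along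
any curve of the hypersurface that leaves `p` with nonzero velocity. -/
def IsHorosphericallyConvexAt (φ η : M → Minkowski n) (p : M) : Prop :=
  (∃ V ∈ 𝓝 p, ∀ q ∈ V, q ≠ p → φ q ∉ horosphere (φ p + η p)) ∧
  ∀ γ : ℝ → M, γ 0 = p → ContMDiffAt 𝓘(ℝ, ℝ) (𝓡 n) ∞ γ 0 →
    mfderiv 𝓘(ℝ, ℝ) (𝓡 n) γ 0 (1 : ℝ) ≠ 0 →
    ¬ (fun s : ℝ => distToHorosphere (φ p + η p) (φ (γ s))) =o[𝓝 0] (fun s : ℝ => s ^ 2)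

/-- The time-`t` leaf of the normal flow,
`φ_t(p) = exp_{φ(p)} (t η(p)) = cosh t • φ(p) + sinh t • η(p)`. -/
def normalFlow (φ η : M → Minkowski n) (t : ℝ) : M → Minkowski n :=
  fun p => Real.cosh t • φ p + Real.sinh t • η p

/-- `f` is an embedded sphere in `ℍ^{n+1}`: a smooth embedding (an immersion that is a homeomorphism
onto its image) into `ℍ^{n+1}` of a manifold diffeomorphic to the standard sphere `𝕊^n`. -/
def IsEmbeddedSphere (f : M → Minkowski n) : Prop :=
  IsImmersedHypersurface f ∧ Topology.IsEmbedding f ∧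
    Nonempty (M ≃ₘ^∞⟮𝓡 n, 𝓡 n⟯ (Metric.sphere (0 : EuclideanSpace ℝ (Fin (n + 1))) 1))

end Hypersurface

end

/-! Put `ψ = φ + η`, a future-directed null field whose ray is the point at infinity of the tangent
horosphere. The velocity of `φ` along any curve is orthogonal to `ψ`, so differentiating `⟨φ(γ(s)),
ψ(p)⟩` gives `-s ⟨dφ(v), dψ(v)⟩ + o(s)`, where `v` is the initial velocity. The distance to the
horosphere is at most `|log(-⟨φ, ψ(p)⟩)|`; if `⟨dφ(v), dψ(v)⟩` vanished for some `v ≠ 0`, this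
distance would be `o(s²)`, against convexity
(`IsHorosphericallyConvexAt.minkowskiForm_mfderiv_ne_zero`).

Since `⟨dφ(v), ψ(p)⟩ = 0`, it follows that `dψ(v)` is never a multiple of `ψ(p)`. Projectivizing the
light cone kills exactly those multiples, so the hyperbolic Gauss map is a local diffeomorphism from
a compact connected manifold to `𝕊^n`. It is therefore a covering, and a diffeomorphism because `n ≥
2` (`ContMDiff.exists_diffeomorph_sphere`).

The Gauss map factors through `ψ`, so `ψ` is an injective immersion. Up to the factor `e^t / 2`, the
leaf `φ_t` is `ψ + e^{-2t} (φ - η)`, and injective immersions of compact manifolds survive small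
perturbations (`eventually_injective_immersion_add_smul`). -/

section MinkowskiForm

variable {n : ℕ}

/-! ### Minkowski algebra, causality and the distance to a horosphere. -/

lemma minkowskiForm_comm (x y : Minkowski n) : minkowskiForm x y = minkowskiForm y x := by
  simp [minkowskiForm, mul_comm]

lemma minkowskiForm_add_left (x y z : Minkowski n) :
    minkowskiForm (x + y) z = minkowskiForm x z + minkowskiForm y z := by
  simp only [minkowskiForm, PiLp.add_apply, add_mul, Finset.sum_add_distrib]
  ring

lemma minkowskiForm_smul_left (c : ℝ) (x y : Minkowski n) :
    minkowskiForm (c • x) y = c * minkowskiForm x y := by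
  simp only [minkowskiForm, PiLp.smul_apply, smul_eq_mul, mul_add, Finset.mul_sum, mul_assoc]
  ring

lemma minkowskiForm_add_right (x y z : Minkowski n) :
    minkowskiForm x (y + z) = minkowskiForm x y + minkowskiForm x z := by
  rw [minkowskiForm_comm, minkowskiForm_add_left, minkowskiForm_comm y, minkowskiForm_comm z]

lemma minkowskiForm_smul_right (c : ℝ) (x y : Minkowski n) :
    minkowskiForm x (c • y) = c * minkowskiForm x y := by
  rw [minkowskiForm_comm, minkowskiForm_smul_left, minkowskiForm_comm y]

lemma minkowskiForm_neg_left (x y : Minkowski n) :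
    minkowskiForm (-x) y = -minkowskiForm x y := by
  rw [← neg_one_smul ℝ x, minkowskiForm_smul_left, neg_one_mul]

lemma minkowskiForm_neg_right (x y : Minkowski n) :
    minkowskiForm x (-y) = -minkowskiForm x y := by
  rw [minkowskiForm_comm, minkowskiForm_neg_left, minkowskiForm_comm y]

lemma minkowskiForm_sub_right (x y z : Minkowski n) :
    minkowskiForm x (y - z) = minkowskiForm x y - minkowskiForm x z := by
  rw [sub_eq_add_neg, minkowskiForm_add_right, minkowskiForm_neg_right, sub_eq_add_neg]

lemma continuous_minkowskiForm :
    Continuous fun z : Minkowski n × Minkowski n => minkowskiForm z.1 z.2 := by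
  unfold minkowskiForm
  fun_prop

/-- The continuous linear functional `x ↦ ⟨x, y⟩`. -/
noncomputable def minkowskiFunctional (y : Minkowski n) : Minkowski n →L[ℝ] ℝ where
  toFun x := minkowskiForm x y
  map_add' x z := minkowskiForm_add_left x z y
  map_smul' c x := minkowskiForm_smul_left c x y
  cont := continuous_minkowskiForm.comp (continuous_id.prodMk continuous_const)

@[simp]
lemma minkowskiFunctional_apply (x y : Minkowski n) :
    minkowskiFunctional y x = minkowskiForm x y := rfl

/-- The reversed Cauchy–Schwarz inequality on hyperbolic space. -/
lemma one_le_neg_minkowskiForm {x y : Minkowski n} (hx : x ∈ hyperbolicSpace n)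
    (hy : y ∈ hyperbolicSpace n) : 1 ≤ -minkowskiForm x y := by
  obtain ⟨hx1, hx0⟩ := hx
  obtain ⟨hy1, hy0⟩ := hy
  have hcs := Finset.sum_mul_sq_le_sq_mul_sq Finset.univ
    (fun i : Fin (n + 1) => x i.succ) (fun i => y i.succ)
  have hamgm : 2 * ∑ i : Fin (n + 1), x i.succ * y i.succ ≤
      ∑ i : Fin (n + 1), x i.succ ^ 2 + ∑ i : Fin (n + 1), y i.succ ^ 2 := by
    rw [Finset.mul_sum, ← Finset.sum_add_distrib]
    exact Finset.sum_le_sum fun i _ => by nlinarith [sq_nonneg (x i.succ - y i.succ)]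
  simp only [minkowskiForm, ← pow_two] at hx1 hy1 ⊢
  set S := ∑ i : Fin (n + 1), x i.succ * y i.succ
  set X := ∑ i : Fin (n + 1), x i.succ ^ 2
  set Y := ∑ i : Fin (n + 1), y i.succ ^ 2
  -- Cauchy–Schwarz `S² ≤ XY` together with `2S ≤ X + Y` gives `(1 + S)² ≤ (1 + X)(1 + Y)`.
  have hsq : (1 + S) ^ 2 ≤ (x 0 * y 0) ^ 2 := by
    have h1 : x 0 ^ 2 = 1 + X := by linarith
    have h2 : y 0 ^ 2 = 1 + Y := by linarith
    rw [mul_pow, h1, h2]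
    nlinarith
  have := abs_le_of_sq_le_sq' hsq (by positivity)
  linarith [this.2]

/-- If `y` were on the lower sheet, the reversed Cauchy–Schwarz inequality for `-y` and `x` would
force `⟨y, x⟩ ≥ 1`. -/
lemma mem_hyperbolicSpace_of_minkowskiForm_neg {x y : Minkowski n} (hx : x ∈ hyperbolicSpace n)
    (hy : minkowskiForm y y = -1) (hxy : minkowskiForm y x < 0) : y ∈ hyperbolicSpace n := by
  refine ⟨hy, ?_⟩
  by_contra! h
  have hne : y 0 ≠ 0 := by
    intro h0
    have : 0 ≤ minkowskiForm y y := by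
      simp only [minkowskiForm, h0, mul_zero, neg_zero, zero_add]
      exact Finset.sum_nonneg fun i _ => mul_self_nonneg _
    linarith
  have hmem : -y ∈ hyperbolicSpace n := by
    refine ⟨by rw [minkowskiForm_neg_left, minkowskiForm_neg_right, neg_neg, hy], ?_⟩
    simpa using lt_of_le_of_ne h hne
  have := one_le_neg_minkowskiForm hmem hx
  rw [minkowskiForm_neg_left] at this
  linarith

lemma sum_succ_sq_of_null {ν : Minkowski n} (hν : minkowskiForm ν ν = 0) :
    ∑ i : Fin (n + 1), ν i.succ ^ 2 = ν 0 ^ 2 := by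
  simp only [minkowskiForm, ← pow_two] at hν
  linarith

/-- A null vector which pairs negatively with a point of hyperbolic space is future directed. -/
lemma zero_coord_pos_of_null {x ν : Minkowski n} (hx : x ∈ hyperbolicSpace n)
    (hν : minkowskiForm ν ν = 0) (hxν : minkowskiForm ν x < 0) : 0 < ν 0 := by
  obtain ⟨hx1, hx0⟩ := hx
  by_contra! h
  have hcs := Finset.sum_mul_sq_le_sq_mul_sq Finset.univ
    (fun i : Fin (n + 1) => ν i.succ) (fun i => x i.succ)
  rw [sum_succ_sq_of_null hν] at hcs
  simp only [minkowskiForm, ← pow_two] at hx1 hxν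
  set S := ∑ i : Fin (n + 1), ν i.succ * x i.succ
  set X := ∑ i : Fin (n + 1), x i.succ ^ 2
  have h1 : X = x 0 ^ 2 - 1 := by linarith
  have h2 : ν 0 * x 0 ≤ 0 := mul_nonpos_of_nonpos_of_nonneg h hx0.le
  rw [h1] at hcs
  nlinarith [sq_nonneg (ν 0)]

/-- The point where the geodesic from `x` to the point at infinity of `ν` meets the horosphere
of `ν` is at distance `|log (-⟨x, ν⟩)|` from `x`. -/
lemma distToHorosphere_le {x ν : Minkowski n} (hx : x ∈ hyperbolicSpace n)
    (hν : minkowskiForm ν ν = 0) (hxν : minkowskiForm x ν < 0) :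
    distToHorosphere ν x ≤ |Real.log (-minkowskiForm x ν)| := by
  obtain ⟨a, ha⟩ : ∃ a, a = -minkowskiForm x ν := ⟨_, rfl⟩
  have ha0 : 0 < a := by linarith
  have hxν' : minkowskiForm x ν = -a := by linarith
  have hνx : minkowskiForm ν x = -a := by rw [minkowskiForm_comm, hxν']
  rw [← ha]
  -- The coefficients of `αx + βν` are forced: `⟨y, ν⟩ = -1` gives `α = 1/a`, and then `⟨y, y⟩ = -1`
  -- gives `β`.
  let y : Minkowski n := a⁻¹ • x + ((a - a⁻¹) / (2 * a)) • ν
  have hyν : minkowskiForm y ν = -1 := by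
    simp only [y, minkowskiForm_add_left, minkowskiForm_smul_left, hxν', hν]
    field_simp
    ring
  have hyx : minkowskiForm y x = -Real.cosh (Real.log a) := by
    simp only [y, minkowskiForm_add_left, minkowskiForm_smul_left, hνx, hx.1, Real.cosh_log ha0]
    field_simp
    ring
  have hyy : minkowskiForm y y = -1 := by
    simp only [y, minkowskiForm_add_left, minkowskiForm_smul_left, minkowskiForm_add_right,
      minkowskiForm_smul_right, hνx, hxν', hν, hx.1]
    field_simp
    ring
  have hy : y ∈ horosphere ν := by
    refine ⟨mem_hyperbolicSpace_of_minkowskiForm_neg hx hyy ?_, hyν⟩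
    rw [hyx]
    linarith [Real.cosh_pos (Real.log a)]
  have hbdd : BddBelow (Set.range fun z : horosphere ν => hyperbolicDist x (z : Minkowski n)) := by
    refine ⟨0, ?_⟩
    rintro _ ⟨z, rfl⟩
    exact Real.arcosh_nonneg (one_le_neg_minkowskiForm hx z.2.1)
  refine (ciInf_le hbdd ⟨y, hy⟩).trans_eq ?_
  rw [hyperbolicDist, minkowskiForm_comm, hyx, neg_neg, ← Real.cosh_abs,
    Real.arcosh_cosh (abs_nonneg _)]

lemma distToHorosphere_nonneg {x : Minkowski n} (ν : Minkowski n) (hx : x ∈ hyperbolicSpace n) :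
    0 ≤ distToHorosphere ν x :=
  Real.iInf_nonneg fun z => Real.arcosh_nonneg (one_le_neg_minkowskiForm hx z.2.1)

end MinkowskiForm

/-! ### Coverings of spheres. -/

section CoveringSphere

open Metric Module

/-- A connected Hausdorff covering space of a sphere of dimension at least two is trivial. -/
theorem IsCoveringMap.injective_of_sphere {n : ℕ} (hn : 2 ≤ n) {V : Type*}
    [NormedAddCommGroup V] [InnerProductSpace ℝ V] [Fact (finrank ℝ V = n + 1)]
    {X : Type*} [TopologicalSpace X] [T2Space X] [PreconnectedSpace X]
    {p : X → sphere (0 : V) 1} (hp : IsCoveringMap p) : Function.Injective p := by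
  -- It is enough to find a continuous section `r` through `e₀`: by uniqueness of lifts `r ∘ p` and
  -- `id`, which agree at `e₀`, agree on all of `X`. The section is glued from lifts over two
  -- punctured spheres.
  suffices key : ∀ e₀ : X, ∃ s : sphere (0 : V) 1 → X, s ∘ p = id by
    intro x y hxy
    obtain ⟨s, hs⟩ := key x
    have h1 := congrFun hs x
    have h2 := congrFun hs y
    simp only [Function.comp_apply, id_eq] at h1 h2
    rw [← h1, hxy, h2]
  intro e₀
  have local_section : ∀ v : sphere (0 : V) 1, v ≠ p e₀ → ∃ s : sphere (0 : V) 1 → X,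
      ContinuousOn s {v}ᶜ ∧ s (p e₀) = e₀ ∧ ∀ x ∈ ({v}ᶜ : Set (sphere (0 : V) 1)), p (s x) = x := by
    intro v hv
    let σ := stereographic' n v
    have hsource : σ.source = {v}ᶜ := stereographic'_source v
    have hmem : p e₀ ∈ σ.source := by
      rw [hsource]
      exact hv.symm
    let f : C(EuclideanSpace ℝ (Fin n), sphere (0 : V) 1) :=
      ⟨σ.symm, by
        have := σ.continuousOn_symm
        rwa [show σ.target = Set.univ from stereographic'_target v,
          continuousOn_univ] at this⟩
    obtain ⟨F, ⟨hF0, hF⟩, -⟩ := hp.existsUnique_continuousMap_lifts f (σ (p e₀)) e₀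
      (σ.left_inv hmem).symm
    refine ⟨F ∘ σ, ?_, hF0, fun x hx => ?_⟩
    · rw [← hsource]
      exact F.continuous.comp_continuousOn σ.continuousOn
    · rw [← hsource] at hx
      exact (congrFun hF (σ x)).trans (σ.left_inv hx)
  obtain ⟨v, w, hvw, hv, hw⟩ : ∃ v w : sphere (0 : V) 1, v ≠ w ∧ v ≠ p e₀ ∧ w ≠ p e₀ := by
    let σ := stereographic' n (p e₀)
    have : Nontrivial (EuclideanSpace ℝ (Fin n)) := by
      have : Nonempty (Fin n) := ⟨⟨0, by omega⟩⟩
      infer_instance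
    obtain ⟨a, b, hab⟩ := exists_pair_ne (EuclideanSpace ℝ (Fin n))
    have hmem : ∀ a, a ∈ σ.target := fun a => by simp [σ]
    have hne : ∀ a, σ.symm a ≠ p e₀ := fun a => by
      have := σ.map_target (hmem a)
      simpa [σ] using this
    exact ⟨σ.symm a, σ.symm b, fun h => hab (σ.symm.injOn (hmem a) (hmem b) h), hne a, hne b⟩
  obtain ⟨s, hsc, hs0, hs⟩ := local_section v hv
  obtain ⟨t, htc, ht0, ht⟩ := local_section w hw
  -- The overlap is `ℝⁿ` minus a point, connected because `n ≥ 2`; hence the two lifts agree on it.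
  have hconn : IsPreconnected ({v}ᶜ ∩ {w}ᶜ : Set (sphere (0 : V) 1)) := by
    let σ := stereographic' n v
    have hsource : σ.source = {v}ᶜ := stereographic'_source v
    have htarget : σ.target = Set.univ := stereographic'_target v
    have himage : ({v}ᶜ ∩ {w}ᶜ : Set (sphere (0 : V) 1)) = σ.symm '' {σ w}ᶜ := by
      ext x
      constructor
      · rintro ⟨hxv, hxw⟩
        rw [← hsource] at hxv
        refine ⟨σ x, fun h => hxw (σ.injOn hxv ?_ h), σ.left_inv hxv⟩
        rw [hsource]
        exact hvw.symm
      · rintro ⟨y, hy, rfl⟩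
        have hyt : y ∈ σ.target := htarget ▸ Set.mem_univ y
        refine ⟨hsource ▸ σ.map_target hyt, fun h => hy ?_⟩
        rw [Set.mem_singleton_iff] at h ⊢
        rw [← h, σ.right_inv hyt]
    rw [himage]
    refine (isConnected_compl_singleton_of_one_lt_rank ?_ _).isPreconnected.image _
      (σ.continuousOn_symm.mono (by rw [htarget]; exact Set.subset_univ _))
    rw [← Module.finrank_eq_rank, finrank_euclideanSpace_fin]
    exact_mod_cast hn
  have hst : Set.EqOn s t ({v}ᶜ ∩ {w}ᶜ) :=
    hp.isSeparatedMap.eqOn_of_comp_eqOn hp.isLocalHomeomorph.isLocallyInjective hconn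
      (hsc.mono Set.inter_subset_left) (htc.mono Set.inter_subset_right)
      (fun x hx => (hs x hx.1).trans (ht x hx.2).symm) ⟨hv.symm, hw.symm⟩ (hs0.trans ht0.symm)
  classical
  let r : sphere (0 : V) 1 → X := fun x => if x = v then t x else s x
  have hrs : Set.EqOn r s {v}ᶜ := fun x hx => if_neg hx
  have hrt : Set.EqOn r t {w}ᶜ := fun x hx => by
    by_cases hxv : x = v
    · exact if_pos hxv
    · exact (if_neg hxv).trans (hst ⟨hxv, hx⟩)
  have hr : Continuous r := by
    rw [continuous_iff_continuousAt]
    intro x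
    by_cases hxv : x = v
    · have hx : ({w}ᶜ : Set (sphere (0 : V) 1)) ∈ 𝓝 x :=
        isOpen_compl_singleton.mem_nhds (by rw [hxv]; exact hvw)
      exact (htc.congr hrt).continuousAt hx
    · exact (hsc.congr hrs).continuousAt (isOpen_compl_singleton.mem_nhds hxv)
  have hpr : ∀ x, p (r x) = x := fun x => by
    by_cases hxv : x = v
    · have hxw : x ∈ ({w}ᶜ : Set (sphere (0 : V) 1)) := by rw [hxv]; exact hvw
      rw [hrt hxw, ht x hxw]
    · rw [hrs hxv, hs x hxv]
  refine ⟨r, ?_⟩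
  refine hp.isSeparatedMap.eq_of_comp_eq hp.isLocalHomeomorph.isLocallyInjective (hr.comp hp.continuous)
    continuous_id (funext fun x => hpr _) e₀ ?_
  exact (hrs hv.symm).trans hs0

end CoveringSphere

/-! ### Local and global inversion on manifolds. -/

section InverseFunction

variable {E : Type*} [NormedAddCommGroup E] [NormedSpace ℝ E] [FiniteDimensional ℝ E]
  {M : Type*} [TopologicalSpace M] [ChartedSpace E M] [IsManifold 𝓘(ℝ, E) ∞ M]
  {N : Type*} [TopologicalSpace N] [ChartedSpace E N] [IsManifold 𝓘(ℝ, E) ∞ N]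

/-- The inverse function theorem for maps between manifolds of the same dimension. -/
theorem ContMDiff.exists_openPartialHomeomorph_of_injective_mfderiv {f : M → N}
    (hf : ContMDiff 𝓘(ℝ, E) 𝓘(ℝ, E) ∞ f) (x : M)
    (hinj : Function.Injective (mfderiv 𝓘(ℝ, E) 𝓘(ℝ, E) f x)) :
    ∃ e : OpenPartialHomeomorph M N, x ∈ e.source ∧ Set.EqOn f e e.source ∧
      ContMDiffAt 𝓘(ℝ, E) 𝓘(ℝ, E) ∞ e.symm (f x) := by
  let c := chartAt E x
  let d := chartAt E (f x)
  have hxc : x ∈ c.source := mem_chart_source E x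
  have hxd : f x ∈ d.source := mem_chart_source E (f x)
  have hcd : ContDiffAt ℝ ∞ (d ∘ f ∘ c.symm) (c x) := by
    have := (contMDiffAt_iff.1 (hf x)).2
    simpa [contDiffWithinAt_univ] using this
  obtain ⟨D, hD⟩ : ∃ D : E →L[ℝ] E, D = mfderiv 𝓘(ℝ, E) 𝓘(ℝ, E) f x := ⟨_, rfl⟩
  have hDinj : Function.Injective D := by
    rw [hD]
    exact hinj
  have hderiv : HasFDerivAt (d ∘ f ∘ c.symm) D (c x) := by
    have := ((hf x).mdifferentiableAt (by simp)).hasMFDerivAt.2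
    simp only [writtenInExtChartAt, mfld_simps] at this
    rw [hD]
    exact hasFDerivWithinAt_univ.1 this
  let L : E ≃L[ℝ] E :=
    (LinearEquiv.ofInjectiveEndo (D : E →ₗ[ℝ] E) hDinj).toContinuousLinearEquiv
  have hL : HasFDerivAt (d ∘ f ∘ c.symm) (L : E →L[ℝ] E) (c x) := hderiv
  have : CompleteSpace E := FiniteDimensional.complete ℝ E
  let ℓ := hcd.toOpenPartialHomeomorph (d ∘ f ∘ c.symm) hL (by simp)
  have hℓ : (ℓ : E → E) = d ∘ f ∘ c.symm := rfl
  have hℓx : c x ∈ ℓ.source := hcd.mem_toOpenPartialHomeomorph_source hL (by simp)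
  have hℓfx : ℓ (c x) = d (f x) := by
    rw [hℓ, Function.comp_apply, Function.comp_apply, c.left_inv hxc]
  let e₀ := c.trans (ℓ.trans d.symm)
  -- The chart expression `d.symm (d (f y))` equals `f y` only where `f y` lies in the source of
  -- `d`, hence the restriction to this open set.
  have hs : IsOpen (f ⁻¹' d.source) := d.open_source.preimage hf.continuous
  have hxe₀ : x ∈ e₀.source := by
    simp only [e₀, OpenPartialHomeomorph.trans_source, Set.mem_inter_iff, Set.mem_preimage,
      OpenPartialHomeomorph.symm_source]
    refine ⟨hxc, hℓx, ?_⟩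
    rw [hℓfx]
    exact d.map_source hxd
  refine ⟨e₀.restrOpen _ hs, ⟨hxe₀, hxd⟩, ?_, ?_⟩
  · rintro y ⟨hy, hyd⟩
    have hyc : y ∈ c.source := hy.1
    change f y = d.symm (d (f (c.symm (c y))))
    rw [c.left_inv hyc, d.left_inv hyd]
  · change ContMDiffAt 𝓘(ℝ, E) 𝓘(ℝ, E) ∞ (c.symm ∘ ℓ.symm ∘ d) (f x)
    have hd : ContMDiffAt 𝓘(ℝ, E) 𝓘(ℝ, E) ∞ d (f x) := contMDiffAt_of_mem_maximalAtlas
      (IsManifold.chart_mem_maximalAtlas (f x)) hxd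
    have hsymm : ℓ.symm (d (f x)) = c x := by rw [← hℓfx, ℓ.left_inv hℓx]
    have hm : ContDiffAt ℝ ∞ ℓ.symm (d (f x)) := by
      have := hcd.to_localInverse hL (by simp)
      rwa [show (d ∘ f ∘ c.symm) (c x) = d (f x) from hℓfx] at this
    have hc : ContMDiffAt 𝓘(ℝ, E) 𝓘(ℝ, E) ∞ c.symm (c x) := contMDiffAt_symm_of_mem_maximalAtlas
      (IsManifold.chart_mem_maximalAtlas x) (c.map_source hxc)
    exact ContMDiffAt.comp (f x) (by rw [Function.comp_apply, hsymm]; exact hc)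
      (ContMDiffAt.comp (f x) hm.contMDiffAt hd)

/-- A smooth map with injective differential from a compact connected manifold to the sphere of the
same dimension `n ≥ 2` is injective, and it is a diffeomorphism. -/
theorem ContMDiff.exists_diffeomorph_sphere {n : ℕ} (hn : 2 ≤ n)
    {M : Type*} [TopologicalSpace M] [T2Space M] [CompactSpace M] [ConnectedSpace M]
    [ChartedSpace (EuclideanSpace ℝ (Fin n)) M] [IsManifold (𝓡 n) ∞ M]
    {f : M → Metric.sphere (0 : EuclideanSpace ℝ (Fin (n + 1))) 1}
    (hf : ContMDiff (𝓡 n) (𝓡 n) ∞ f)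
    (hinj : ∀ x, Function.Injective (mfderiv (𝓡 n) (𝓡 n) f x)) :
    ∃ Φ : M ≃ₘ^∞⟮𝓡 n, 𝓡 n⟯ (Metric.sphere (0 : EuclideanSpace ℝ (Fin (n + 1))) 1), ⇑Φ = f := by
  have : Fact (Module.finrank ℝ (EuclideanSpace ℝ (Fin (n + 1))) = n + 1) :=
    ⟨finrank_euclideanSpace_fin⟩
  have hloc := fun x => hf.exists_openPartialHomeomorph_of_injective_mfderiv x (hinj x)
  have hlh : IsLocalHomeomorph f := IsLocalHomeomorph.mk f fun x => by
    obtain ⟨e, hx, he, -⟩ := hloc x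
    exact ⟨e, hx, he⟩
  have hfi : Function.Injective f :=
    (isLocalHomeomorph_iff_isCoveringMap.1 hlh).injective_of_sphere hn
  have hfs : Function.Surjective f := by
    have : PreconnectedSpace (Metric.sphere (0 : EuclideanSpace ℝ (Fin (n + 1))) 1) := by
      refine isPreconnected_iff_preconnectedSpace.1 (isPreconnected_sphere ?_ _ _)
      rw [← Module.finrank_eq_rank, finrank_euclideanSpace_fin]
      exact_mod_cast (by omega : 1 < n + 1)
    rw [← Set.range_eq_univ]
    exact IsClopen.eq_univ ⟨(isCompact_range hf.continuous).isClosed,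
      hlh.isOpenMap.isOpen_range⟩ (Set.range_nonempty f)
  let g := Equiv.ofBijective f ⟨hfi, hfs⟩
  refine ⟨⟨g, hf, fun y => ?_⟩, rfl⟩
  obtain ⟨x, rfl⟩ := hfs y
  obtain ⟨e, hx, he, hes⟩ := hloc x
  -- Near `f x` the global inverse coincides with the smooth local inverse `e.symm`.
  refine hes.congr_of_eventuallyEq ?_
  have hmem : f x ∈ e.target := by
    rw [he hx]
    exact e.map_source hx
  filter_upwards [e.open_target.mem_nhds hmem] with y hy
  apply hfi
  exact (g.apply_symm_apply y).trans (by rw [he (e.map_target hy), e.right_inv hy])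

end InverseFunction

/-! ### Stability of injective immersions. -/

section Perturbation

open Filter

/-- A map whose strict derivative at `a` is injective is injective near `a`. -/
theorem HasStrictFDerivAt.exists_injOn_of_injective {E F : Type*} [NormedAddCommGroup E]
    [NormedSpace ℝ E] [FiniteDimensional ℝ E] [NormedAddCommGroup F] [NormedSpace ℝ F]
    {f : E → F} {f' : E →L[ℝ] F} {a : E} (hf : HasStrictFDerivAt f f' a)
    (hinj : Function.Injective f') : ∃ s ∈ 𝓝 a, Set.InjOn f s := by
  obtain ⟨K, hK0, hK⟩ := (f' : E →ₗ[ℝ] F).exists_antilipschitzWith (LinearMap.ker_eq_bot.2 hinj)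
  -- Since `‖v‖ ≤ K ‖f' v‖`, an error of `K⁻¹ / 2` in the linear approximation turns `f x = f y`
  -- into `‖x - y‖ ≤ ‖x - y‖ / 2`.
  have hc : 0 < K⁻¹ / 2 := half_pos (inv_pos.2 hK0)
  obtain ⟨s, hs, happ⟩ := hf.approximates_deriv_on_nhds (Or.inr hc)
  refine ⟨s, hs, fun x hx y hy hxy => ?_⟩
  have h1 := happ x hx y hy
  rw [hxy, sub_self, zero_sub, norm_neg] at h1
  have h2 := hK.le_mul_dist (x - y) 0
  simp only [map_zero, dist_zero_right] at h2
  have hK0' : (0 : ℝ) < K := hK0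
  have h3 : ‖x - y‖ ≤ ‖x - y‖ / 2 := calc
    ‖x - y‖ ≤ K * ‖f' (x - y)‖ := h2
    _ ≤ K * (((K⁻¹ / 2 : NNReal) : ℝ) * ‖x - y‖) := by gcongr
    _ = ‖x - y‖ / 2 := by
      push_cast
      field_simp
  have h4 : ‖x - y‖ = 0 := le_antisymm (by linarith) (norm_nonneg _)
  exact sub_eq_zero.1 (norm_eq_zero.1 h4)

variable {E : Type*} [NormedAddCommGroup E] [NormedSpace ℝ E]
  {F : Type*} [NormedAddCommGroup F] [NormedSpace ℝ F]
  {M : Type*} [TopologicalSpace M] [ChartedSpace E M]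

lemma ContMDiff.fderiv_comp_chartAt_symm {f : M → F} (hf : ContMDiff 𝓘(ℝ, E) 𝓘(ℝ, F) ∞ f)
    (p : M) : fderiv ℝ (f ∘ (chartAt E p).symm) (chartAt E p p) =
      (mfderiv 𝓘(ℝ, E) 𝓘(ℝ, F) f p : E →L[ℝ] F) := by
  obtain ⟨D, hD⟩ : ∃ D : E →L[ℝ] F, D = mfderiv 𝓘(ℝ, E) 𝓘(ℝ, F) f p := ⟨_, rfl⟩
  have hd : HasFDerivAt (f ∘ (chartAt E p).symm) D (chartAt E p p) := by
    have := ((hf p).mdifferentiableAt (by simp)).hasMFDerivAt.2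
    simp only [writtenInExtChartAt, mfld_simps] at this
    rw [hD]
    exact hasFDerivWithinAt_univ.1 this
  rw [← hD]
  exact hd.fderiv

variable [IsManifold 𝓘(ℝ, E) ∞ M]

lemma ContMDiff.contDiffOn_comp_chartAt_symm {f : M → F} (hf : ContMDiff 𝓘(ℝ, E) 𝓘(ℝ, F) ∞ f)
    (p : M) : ContDiffOn ℝ ∞ (f ∘ (chartAt E p).symm) (chartAt E p).target := by
  rw [← contMDiffOn_iff_contDiffOn]
  exact hf.comp_contMDiffOn (contMDiffOn_chart_symm (I := 𝓘(ℝ, E)))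

lemma injective_mfderiv_of_injective_fderiv_comp_chartAt_symm {f : M → F}
    (hf : ContMDiff 𝓘(ℝ, E) 𝓘(ℝ, F) ∞ f) (p : M) {q : M} (hq : q ∈ (chartAt E p).source)
    (hinj : Function.Injective (fderiv ℝ (f ∘ (chartAt E p).symm) (chartAt E p q))) :
    Function.Injective (mfderiv 𝓘(ℝ, E) 𝓘(ℝ, F) f q) := by
  have hdiff : DifferentiableAt ℝ (f ∘ (chartAt E p).symm) (chartAt E p q) :=
    ((hf.contDiffOn_comp_chartAt_symm p).contDiffAt ((chartAt E p).open_target.mem_nhds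
      ((chartAt E p).map_source hq))).differentiableAt (by simp)
  have : IsManifold 𝓘(ℝ, E) 1 M := IsManifold.of_le (n := ∞) (by simp)
  have hchart : MDifferentiableAt 𝓘(ℝ, E) 𝓘(ℝ, E) (extChartAt 𝓘(ℝ, E) p) q :=
    mdifferentiableAt_extChartAt hq
  have hcomp := hdiff.hasFDerivAt.hasMFDerivAt.comp q
    (g := f ∘ (chartAt E p).symm) (f := extChartAt 𝓘(ℝ, E) p) hchart.hasMFDerivAt
  have heq : f =ᶠ[𝓝 q] (f ∘ (chartAt E p).symm) ∘ extChartAt 𝓘(ℝ, E) p := by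
    filter_upwards [(chartAt E p).open_source.mem_nhds hq] with y hy
    simp [(chartAt E p).left_inv hy]
  rw [(hcomp.congr_of_eventuallyEq heq).mfderiv]
  have hinv := isInvertible_mfderiv_extChartAt (I := 𝓘(ℝ, E)) (x := p) (y := q)
    (by simpa using hq)
  exact hinj.comp hinv.injective

/-- Injective immersions of compact manifolds are stable under the perturbation
`ψ + ε • χ` for small `ε`. -/
theorem eventually_injective_immersion_add_smul [FiniteDimensional ℝ E] [CompactSpace M] {ψ χ : M → F}
    (hψ : ContMDiff 𝓘(ℝ, E) 𝓘(ℝ, F) ∞ ψ) (hχ : ContMDiff 𝓘(ℝ, E) 𝓘(ℝ, F) ∞ χ)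
    (hinj : Function.Injective ψ)
    (himm : ∀ p, Function.Injective (mfderiv 𝓘(ℝ, E) 𝓘(ℝ, F) ψ p)) :
    ∀ᶠ ε in 𝓝 (0 : ℝ), Function.Injective (fun p => ψ p + ε • χ p) ∧
      ∀ p, Function.Injective (mfderiv 𝓘(ℝ, E) 𝓘(ℝ, F) (fun p => ψ p + ε • χ p) p) := by
  refine Filter.Eventually.and ?_ ?_
  -- Compactness of `M × M` reduces the claim to a neighbourhood of each pair. Off the diagonal this
  -- is continuity; on it, local injectivity must hold uniformly in `ε`.
  · have key : ∀ᶠ ε in 𝓝 (0 : ℝ), ∀ z ∈ (Set.univ : Set (M × M)),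
        ψ z.1 + ε • χ z.1 = ψ z.2 + ε • χ z.2 → z.1 = z.2 := by
      refine isCompact_univ.eventually_forall_of_forall_eventually ?_
      rintro ⟨p, q⟩ -
      have hψc := hψ.continuous
      have hχc := hχ.continuous
      by_cases hpq : p = q
      · subst hpq
        let c := chartAt E p
        have hcp : c.target ∈ 𝓝 (c p) := c.open_target.mem_nhds (mem_chart_target E p)
        have hψs := ((hψ.contDiffOn_comp_chartAt_symm p).contDiffAt hcp).hasStrictFDerivAt
          (by simp)
        have hχs := ((hχ.contDiffOn_comp_chartAt_symm p).contDiffAt hcp).hasStrictFDerivAt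
          (by simp)
        rw [hψ.fderiv_comp_chartAt_symm p] at hψs
        -- Uniformity comes from keeping the parameter as a coordinate: `(ε, x) ↦ (ε, ψ + ε χ)` has
        -- injective strict derivative at `(0, c p)`, so it is injective on a full neighbourhood.
        let z₀ : ℝ × E := (0, c p)
        have hfst : HasStrictFDerivAt (fun z : ℝ × E => z.1) (ContinuousLinearMap.fst ℝ ℝ E) z₀ :=
          hasStrictFDerivAt_fst
        have hsnd : HasStrictFDerivAt (fun z : ℝ × E => z.2) (ContinuousLinearMap.snd ℝ ℝ E) z₀ :=
          hasStrictFDerivAt_snd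
        have hstrict := hfst.prodMk
          ((HasStrictFDerivAt.comp z₀ (f := fun z : ℝ × E => z.2) hψs hsnd).add
          (hfst.smul (HasStrictFDerivAt.comp z₀ (f := fun z : ℝ × E => z.2) hχs hsnd)))
        obtain ⟨s, hs, hsinj⟩ := hstrict.exists_injOn_of_injective (by
          rw [injective_iff_map_eq_zero]
          rintro ⟨a, v⟩ hav
          simp only [ContinuousLinearMap.prod_apply, ContinuousLinearMap.coe_fst', Prod.mk_eq_zero]
            at hav
          obtain ⟨rfl, hv⟩ := hav
          simp [z₀] at hv
          have hv0 : v = 0 := himm p (hv.trans (map_zero _).symm)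
          rw [hv0]
          rfl)
        have hcc : ContinuousAt c p := c.continuousAt (mem_chart_source E p)
        have h1 : Tendsto (fun w : ℝ × (M × M) => ((w.1, c w.2.1) : ℝ × E))
            (𝓝 (0, (p, p))) (𝓝 z₀) := by
          refine Tendsto.prodMk_nhds continuous_fst.continuousAt ?_
          exact Tendsto.comp hcc (continuous_fst.comp continuous_snd).continuousAt
        have h2 : Tendsto (fun w : ℝ × (M × M) => ((w.1, c w.2.2) : ℝ × E))
            (𝓝 (0, (p, p))) (𝓝 z₀) := by
          refine Tendsto.prodMk_nhds continuous_fst.continuousAt ?_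
          exact Tendsto.comp hcc (continuous_snd.comp continuous_snd).continuousAt
        have h3 : ∀ᶠ w : ℝ × (M × M) in 𝓝 (0, (p, p)), w.2.1 ∈ c.source :=
          (continuous_fst.comp continuous_snd).continuousAt.eventually
            (c.open_source.mem_nhds (mem_chart_source E p))
        have h4 : ∀ᶠ w : ℝ × (M × M) in 𝓝 (0, (p, p)), w.2.2 ∈ c.source :=
          (continuous_snd.comp continuous_snd).continuousAt.eventually
            (c.open_source.mem_nhds (mem_chart_source E p))
        filter_upwards [h1 hs, h2 hs, h3, h4] with w hw1 hw2 hw3 hw4 heq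
        have := hsinj hw1 hw2 (by
          simp only [Function.comp_apply, Prod.mk.injEq, true_and]
          simpa [c, c.left_inv hw3, c.left_inv hw4] using heq)
        exact c.injOn hw3 hw4 (congrArg Prod.snd this)
      · have hne : ψ p + (0 : ℝ) • χ p ≠ ψ q + (0 : ℝ) • χ q := by
          simpa using hinj.ne hpq
        have hcont : Continuous fun w : ℝ × (M × M) => ψ w.2.1 + w.1 • χ w.2.1 := by fun_prop
        have hcont' : Continuous fun w : ℝ × (M × M) => ψ w.2.2 + w.1 • χ w.2.2 := by fun_prop
        filter_upwards [(isOpen_ne_fun hcont hcont').mem_nhds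
          (show ((0, (p, q)) : ℝ × (M × M)) ∈ _ from hne)] with w hw heq
        exact absurd heq hw
    filter_upwards [key] with ε hε p q hpq
    exact hε (p, q) (Set.mem_univ _) hpq
  · have key : ∀ᶠ ε in 𝓝 (0 : ℝ), ∀ p ∈ (Set.univ : Set M),
        Function.Injective (mfderiv 𝓘(ℝ, E) 𝓘(ℝ, F) (fun p => ψ p + ε • χ p) p) := by
      refine isCompact_univ.eventually_forall_of_forall_eventually fun p _ => ?_
      let c := chartAt E p
      have hcp : c.target ∈ 𝓝 (c p) := c.open_target.mem_nhds (mem_chart_target E p)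
      have hψd := (hψ.contDiffOn_comp_chartAt_symm p)
      have hχd := (hχ.contDiffOn_comp_chartAt_symm p)
      have hψ' : ContinuousAt (fderiv ℝ (ψ ∘ c.symm)) (c p) :=
        (hψd.continuousOn_fderiv_of_isOpen c.open_target (by simp)).continuousAt hcp
      have hχ' : ContinuousAt (fderiv ℝ (χ ∘ c.symm)) (c p) :=
        (hχd.continuousOn_fderiv_of_isOpen c.open_target (by simp)).continuousAt hcp
      have hcc : Tendsto (fun w : ℝ × M => c w.2) (𝓝 (0, p)) (𝓝 (c p)) :=
        Tendsto.comp (c.continuousAt (mem_chart_source E p)) continuous_snd.continuousAt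
      have hlim : Tendsto (fun w : ℝ × M => fderiv ℝ (ψ ∘ c.symm) (c w.2) +
          w.1 • fderiv ℝ (χ ∘ c.symm) (c w.2)) (𝓝 (0, p))
          (𝓝 (fderiv ℝ (ψ ∘ c.symm) (c p) + (0 : ℝ) • fderiv ℝ (χ ∘ c.symm) (c p))) :=
        (hψ'.tendsto.comp hcc).add
          (Tendsto.smul continuous_fst.continuousAt (hχ'.tendsto.comp hcc))
      -- Injectivity is an open condition on linear maps from a finite-dimensional space, and the
      -- derivative in the chart is jointly continuous in `ε` and the point.
      have hopen := hlim.eventually (ContinuousLinearMap.isOpen_injective.mem_nhds (by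
        rw [zero_smul, add_zero, hψ.fderiv_comp_chartAt_symm p]
        exact himm p))
      have hsrc : ∀ᶠ w : ℝ × M in 𝓝 (0, p), w.2 ∈ c.source :=
        continuous_snd.continuousAt.eventually
          (c.open_source.mem_nhds (mem_chart_source E p))
      filter_upwards [hopen, hsrc] with w hw hwc
      refine injective_mfderiv_of_injective_fderiv_comp_chartAt_symm
        (hψ.add ((contDiff_const_smul w.1).contMDiff.comp hχ)) p hwc ?_
      have hmem : c.target ∈ 𝓝 (c w.2) := c.open_target.mem_nhds (c.map_source hwc)
      have h1 := (hψd.contDiffAt hmem).differentiableAt (by simp)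
      have h2 := (hχd.contDiffAt hmem).differentiableAt (by simp)
      have h3 := (h1.hasFDerivAt.add (h2.hasFDerivAt.const_smul w.1)).fderiv
      convert! hw using 2
    filter_upwards [key] with ε hε p using hε p (Set.mem_univ p)

end Perturbation

/-! ### Second-order contact of curves with horospheres. -/

section Curves

open Filter Asymptotics

variable {n : ℕ}

/-- A curve in hyperbolic space is orthogonal to its velocity. -/
lemma minkowskiForm_deriv_self {g : ℝ → Minkowski n} {g' : Minkowski n} {s : ℝ}
    (hg : HasDerivAt g g' s) (hH : ∀ r, g r ∈ hyperbolicSpace n) :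
    minkowskiForm g' (g s) = 0 := by
  -- The pairing `⟨g r - g s, g r + g s⟩ = ⟨g r, g r⟩ - ⟨g s, g s⟩` vanishes identically.
  have h1 : Tendsto (fun r => minkowskiForm (slope g s r) (g r + g s)) (𝓝[≠] s)
      (𝓝 (minkowskiForm g' (g s + g s))) :=
    (continuous_minkowskiForm.tendsto (g', g s + g s)).comp
      ((hasDerivAt_iff_tendsto_slope.1 hg).prodMk_nhds
        ((hg.continuousAt.tendsto.mono_left nhdsWithin_le_nhds).add_const (g s)))
  have h2 : (fun r => minkowskiForm (slope g s r) (g r + g s)) = fun _ => (0 : ℝ) := by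
    funext r
    rw [slope_def_module, minkowskiForm_smul_left, minkowskiForm_comm, minkowskiForm_sub_right,
      minkowskiForm_add_left, minkowskiForm_add_left, (hH r).1, (hH s).1,
      minkowskiForm_comm (g s) (g r)]
    ring
  rw [h2] at h1
  have h3 := tendsto_nhds_unique h1 tendsto_const_nhds
  rw [minkowskiForm_add_right] at h3
  linarith

/-- If `⟨g', h⟩ = 0` along the curves `g`, `h` and `⟨g'(0), h'(0)⟩ = 0`, then `⟨g, h(0)⟩` is constant
up to second order. -/
lemma isLittleO_minkowskiForm_sub {g h g' : ℝ → Minkowski n} {h' : Minkowski n}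
    (hg : ∀ᶠ s in 𝓝 0, HasDerivAt g (g' s) s) (hg' : ContinuousAt g' 0) (hh : HasDerivAt h h' 0)
    (horth : ∀ᶠ s in 𝓝 0, minkowskiForm (g' s) (h s) = 0) (hzero : minkowskiForm (g' 0) h' = 0) :
    (fun s => minkowskiForm (g s) (h 0) - minkowskiForm (g 0) (h 0)) =o[𝓝 0]
      fun s : ℝ => s ^ 2 := by
  -- By orthogonality, `⟨g'(s), h(0)⟩ = -⟨g'(s), h(s) - h(0)⟩`, which is `-s` times this pairing. So
  -- the derivative of `⟨g, h(0)⟩` is `o(s)`, and the mean value inequality makes its increment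
  -- `o(s²)`.
  have hlim : Tendsto (fun s => minkowskiForm (g' s) (slope h 0 s)) (𝓝[≠] 0) (𝓝 0) := by
    have := (continuous_minkowskiForm.tendsto (g' 0, h')).comp
      ((hg'.tendsto.mono_left nhdsWithin_le_nhds).prodMk_nhds (hasDerivAt_iff_tendsto_slope.1 hh))
    rwa [hzero] at this
  rw [isLittleO_iff]
  intro ε hε
  have hsmall := eventually_nhdsWithin_iff.1 (hlim.eventually (Metric.ball_mem_nhds 0 hε))
  have hbound : ∀ᶠ s in 𝓝 (0 : ℝ), ‖minkowskiForm (g' s) (h 0)‖ ≤ ε * ‖s‖ := by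
    filter_upwards [hsmall, horth] with s hs hso
    by_cases hs0 : s = 0
    · rw [hs0, horth.self_of_nhds]
      simp
    · have hlt := hs hs0
      rw [dist_zero_right, slope_def_module, sub_zero, minkowskiForm_smul_right,
        minkowskiForm_sub_right, hso, zero_sub, norm_mul, norm_neg, norm_inv] at hlt
      have hpos : 0 < ‖s‖ := norm_pos_iff.2 hs0
      rw [inv_mul_lt_iff₀ hpos] at hlt
      linarith
  obtain ⟨δ, hδ, hball⟩ := Metric.eventually_nhds_iff_ball.1 (hg.and hbound)
  filter_upwards [Metric.ball_mem_nhds 0 hδ] with s hs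
  have hsub : ∀ r ∈ Metric.closedBall (0 : ℝ) ‖s‖, r ∈ Metric.ball (0 : ℝ) δ := fun r hr => by
    rw [mem_ball_zero_iff] at hs ⊢
    exact (mem_closedBall_zero_iff.1 hr).trans_lt hs
  have := Convex.norm_image_sub_le_of_norm_hasDerivWithin_le
    (f := fun r => minkowskiForm (g r) (h 0)) (f' := fun r => minkowskiForm (g' r) (h 0))
    (s := Metric.closedBall 0 ‖s‖) (x := 0) (y := s) (C := ε * ‖s‖)
    (fun r hr => ((minkowskiFunctional (h 0)).hasFDerivAt.comp_hasDerivAt r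
      (hball r (hsub r hr)).1).hasDerivWithinAt)
    (fun r hr => ((hball r (hsub r hr)).2).trans
      (by gcongr; exact mem_closedBall_zero_iff.1 hr))
    (convex_closedBall 0 _) (by simp) (by simp)
  rw [sub_zero] at this
  rw [norm_pow, pow_two, ← mul_assoc]
  exact this

/-- The distance lies between `0` and `|log(-⟨g s, ν⟩)|`, and `log u = O(u - 1)` at `u = 1`. -/
lemma isLittleO_distToHorosphere {g : ℝ → Minkowski n} {ν : Minkowski n}
    (hg : ContinuousAt g 0) (hH : ∀ s, g s ∈ hyperbolicSpace n) (hν : minkowskiForm ν ν = 0)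
    (h0 : minkowskiForm (g 0) ν = -1)
    (hF : (fun s => minkowskiForm (g s) ν - minkowskiForm (g 0) ν) =o[𝓝 0] fun s : ℝ => s ^ 2) :
    (fun s => distToHorosphere ν (g s)) =o[𝓝 0] fun s : ℝ => s ^ 2 := by
  have hlim : Tendsto (fun s => -minkowskiForm (g s) ν) (𝓝 0) (𝓝 1) := by
    have := ((minkowskiFunctional ν).continuous.tendsto (g 0)).comp hg.tendsto
    simpa [h0] using this.neg
  have hlog : (fun s => Real.log (-minkowskiForm (g s) ν)) =O[𝓝 0]
      fun s => -minkowskiForm (g s) ν - 1 := by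
    have := (Real.hasDerivAt_log one_ne_zero).isBigO_sub.comp_tendsto hlim
    simpa [Function.comp_def] using this
  have hlog' : (fun s => Real.log (-minkowskiForm (g s) ν)) =o[𝓝 0] fun s : ℝ => s ^ 2 := by
    refine hlog.trans_isLittleO (hF.neg_left.congr_left fun s => ?_)
    rw [h0]
    ring
  refine IsBigO.trans_isLittleO (IsBigO.of_bound 1 ?_) hlog'
  filter_upwards [hlim.eventually (lt_mem_nhds one_pos)] with s hs
  rw [one_mul, Real.norm_of_nonneg (distToHorosphere_nonneg ν (hH s)), Real.norm_eq_abs]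
  exact distToHorosphere_le (hH s) hν (by linarith)

end Curves

/-! ### The null field `φ + η` and horospherical convexity. -/

section Hypersurface

variable {n : ℕ} {M : Type*} [TopologicalSpace M] [ChartedSpace (EuclideanSpace ℝ (Fin n)) M]
  {φ η : M → Minkowski n}

lemma IsUnitNormal.minkowskiForm_add_self (hφ : IsImmersedHypersurface φ) (hη : IsUnitNormal φ η)
    (p : M) : minkowskiForm (φ p + η p) (φ p + η p) = 0 := by
  rw [minkowskiForm_add_left, minkowskiForm_add_right, minkowskiForm_add_right,
    (hφ.mem_hyperbolicSpace p).1, hη.unit, hη.tangent, minkowskiForm_comm, hη.tangent]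
  ring

lemma IsUnitNormal.minkowskiForm_add_right (hφ : IsImmersedHypersurface φ)
    (hη : IsUnitNormal φ η) (p : M) : minkowskiForm (φ p) (φ p + η p) = -1 := by
  rw [_root_.minkowskiForm_add_right, (hφ.mem_hyperbolicSpace p).1, minkowskiForm_comm,
    hη.tangent, add_zero]

lemma IsUnitNormal.zero_coord_add_pos (hφ : IsImmersedHypersurface φ) (hη : IsUnitNormal φ η)
    (p : M) : 0 < (φ p + η p) 0 :=
  zero_coord_pos_of_null (hφ.mem_hyperbolicSpace p) (hη.minkowskiForm_add_self hφ p) (by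
    rw [minkowskiForm_comm, hη.minkowskiForm_add_right hφ]
    norm_num)

lemma IsUnitNormal.normalFlow_mem_hyperbolicSpace (hφ : IsImmersedHypersurface φ)
    (hη : IsUnitNormal φ η) (t : ℝ) (p : M) : normalFlow φ η t p ∈ hyperbolicSpace n := by
  have h1 := (hφ.mem_hyperbolicSpace p).1
  have h2 := hη.unit p
  have h3 := hη.tangent p
  have h4 : minkowskiForm (φ p) (η p) = 0 := by rw [minkowskiForm_comm, h3]
  refine mem_hyperbolicSpace_of_minkowskiForm_neg (hφ.mem_hyperbolicSpace p) ?_ ?_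
  · simp only [normalFlow, minkowskiForm_add_left, _root_.minkowskiForm_add_right,
      minkowskiForm_smul_left, minkowskiForm_smul_right, h1, h2, h3, h4]
    nlinarith [Real.cosh_sq t]
  · simp only [normalFlow, minkowskiForm_add_left, minkowskiForm_smul_left, h1, h3]
    linarith [Real.cosh_pos t]

/-- The derivative of `f` along a smooth curve of `M`. -/
lemma hasDerivAt_comp_curve {F : Type*} [NormedAddCommGroup F] [NormedSpace ℝ F] {f : M → F}
    (hf : ContMDiff (𝓡 n) 𝓘(ℝ, F) ∞ f) {γ : ℝ → M} {s : ℝ}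
    (hγ : ContMDiffAt 𝓘(ℝ, ℝ) (𝓡 n) ∞ γ s) :
    HasDerivAt (f ∘ γ)
      (mfderiv (𝓡 n) 𝓘(ℝ, F) f (γ s) (mfderiv 𝓘(ℝ, ℝ) (𝓡 n) γ s (1 : ℝ)) : F) s := by
  obtain ⟨D, hD⟩ : ∃ D : ℝ →L[ℝ] F, D = (mfderiv (𝓡 n) 𝓘(ℝ, F) f (γ s)).comp
    (mfderiv 𝓘(ℝ, ℝ) (𝓡 n) γ s) := ⟨_, rfl⟩
  have h1 := ((hf (γ s)).mdifferentiableAt (by simp)).hasMFDerivAt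
  have h2 := (hγ.mdifferentiableAt (by simp)).hasMFDerivAt
  have h3 := h1.comp s h2
  have h4 : HasFDerivAt (f ∘ γ) D s := by
    rw [hD]
    exact hasMFDerivAt_iff_hasFDerivAt.1 h3
  have h5 := h4.hasDerivAt
  rwa [hD] at h5

lemma IsUnitNormal.minkowskiForm_deriv_add (hφ : IsImmersedHypersurface φ)
    (hη : IsUnitNormal φ η) {γ : ℝ → M} {s : ℝ} (hγ : ContMDiffAt 𝓘(ℝ, ℝ) (𝓡 n) ∞ γ s) :
    minkowskiForm (deriv (φ ∘ γ) s) (φ (γ s) + η (γ s)) = 0 := by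
  have hd := hasDerivAt_comp_curve hφ.contMDiff hγ
  have h1 : minkowskiForm (deriv (φ ∘ γ) s) (φ (γ s)) = 0 :=
    minkowskiForm_deriv_self hd.differentiableAt.hasDerivAt fun r => hφ.mem_hyperbolicSpace _
  have h2 : minkowskiForm (η (γ s)) (deriv (φ ∘ γ) s) = 0 := by
    rw [hd.deriv]
    exact hη.normal (γ s) _
  rw [_root_.minkowskiForm_add_right, h1, minkowskiForm_comm, h2, add_zero]

variable [IsManifold (𝓡 n) ∞ M]

/-- Through every tangent vector there is a smooth curve, a line in a chart. -/
lemma exists_curve_hasDerivAt_comp (p : M) (v : EuclideanSpace ℝ (Fin n)) :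
    ∃ γ : ℝ → M, γ 0 = p ∧ (∀ᶠ s in 𝓝 (0 : ℝ), ContMDiffAt 𝓘(ℝ, ℝ) (𝓡 n) ∞ γ s) ∧
      ∀ f : M → Minkowski n, ContMDiff (𝓡 n) 𝓘(ℝ, Minkowski n) ∞ f →
        HasDerivAt (f ∘ γ) (mfderiv (𝓡 n) 𝓘(ℝ, Minkowski n) f p v : Minkowski n) 0 := by
  let c := chartAt (EuclideanSpace ℝ (Fin n)) p
  let ℓ : ℝ → EuclideanSpace ℝ (Fin n) := fun s => c p + s • v
  have hℓ : ContDiff ℝ ∞ ℓ := by fun_prop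
  have hℓ0 : ℓ 0 = c p := by simp [ℓ]
  have hℓd : HasDerivAt ℓ v 0 := by
    have := ((hasDerivAt_id (0 : ℝ)).smul_const v).const_add (c p)
    rwa [one_smul] at this
  have hcp : c p ∈ c.target := mem_chart_target _ p
  refine ⟨c.symm ∘ ℓ, ?_, ?_, fun f hf => ?_⟩
  · rw [Function.comp_apply, hℓ0]
    exact c.left_inv (mem_chart_source _ p)
  · have hmem : ∀ᶠ s in 𝓝 (0 : ℝ), ℓ s ∈ c.target :=
      hℓ.continuous.continuousAt.eventually
        (c.open_target.mem_nhds (by rw [hℓ0]; exact hcp))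
    filter_upwards [hmem] with s hs
    exact (contMDiffAt_symm_of_mem_maximalAtlas (IsManifold.chart_mem_maximalAtlas p) hs).comp s
      hℓ.contMDiff.contMDiffAt
  · have h1 : HasFDerivAt (f ∘ c.symm) (fderiv ℝ (f ∘ c.symm) (c p)) (ℓ 0) := by
      rw [hℓ0]
      exact (((hf.contDiffOn_comp_chartAt_symm p).contDiffAt
        (c.open_target.mem_nhds hcp)).differentiableAt (by simp)).hasFDerivAt
    have h2 := h1.comp_hasDerivAt 0 hℓd
    rwa [hf.fderiv_comp_chartAt_symm p] at h2

lemma IsUnitNormal.minkowskiForm_mfderiv_add (hφ : IsImmersedHypersurface φ)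
    (hη : IsUnitNormal φ η) (p : M) (v : EuclideanSpace ℝ (Fin n)) :
    minkowskiForm (mfderiv (𝓡 n) 𝓘(ℝ, Minkowski n) φ p v : Minkowski n) (φ p + η p) = 0 := by
  obtain ⟨γ, hγ0, hγ, hderiv⟩ := exists_curve_hasDerivAt_comp p v
  have := hη.minkowskiForm_deriv_add hφ hγ.self_of_nhds
  rwa [(hderiv φ hφ.contMDiff).deriv, hγ0] at this

/-- Horospherical convexity: the quadratic form `⟨dφ(v), d(φ + η)(v)⟩`, which measures the contact of
the hypersurface with its tangent horosphere, has no isotropic vectors. -/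
theorem IsHorosphericallyConvexAt.minkowskiForm_mfderiv_ne_zero (hφ : IsImmersedHypersurface φ)
    (hη : IsUnitNormal φ η) {p : M} (hconv : IsHorosphericallyConvexAt φ η p)
    {v : EuclideanSpace ℝ (Fin n)} (hv : v ≠ 0) :
    minkowskiForm (mfderiv (𝓡 n) 𝓘(ℝ, Minkowski n) φ p v : Minkowski n)
      (mfderiv (𝓡 n) 𝓘(ℝ, Minkowski n) (fun q => φ q + η q) p v : Minkowski n) ≠ 0 := by
  intro hzero
  obtain ⟨γ, hγ0, hγ, hderiv⟩ := exists_curve_hasDerivAt_comp p v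
  have hψ : ContMDiff (𝓡 n) 𝓘(ℝ, Minkowski n) ∞ (fun q => φ q + η q) :=
    hφ.contMDiff.add hη.contMDiff
  have hdφ := hderiv φ hφ.contMDiff
  -- The curve is known only through the derivatives of `f ∘ γ`; its velocity is nonzero because `φ`
  -- is an immersion and `dφ(v) ≠ 0`.
  have hvel : mfderiv 𝓘(ℝ, ℝ) (𝓡 n) γ 0 (1 : ℝ) ≠ 0 := by
    intro h0
    have h1 := hasDerivAt_comp_curve hφ.contMDiff hγ.self_of_nhds
    rw [h0, map_zero] at h1
    have h2 := hdφ.unique h1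
    exact hv (hφ.injective_mfderiv p (h2.trans (map_zero _).symm))
  have hsmooth : ContDiffAt ℝ ∞ (φ ∘ γ) 0 :=
    contMDiffAt_iff_contDiffAt.1 (hφ.contMDiff.contMDiffAt.comp 0 hγ.self_of_nhds)
  have hlittle := isLittleO_minkowskiForm_sub (g := φ ∘ γ) (g' := deriv (φ ∘ γ))
    (h := fun s => φ (γ s) + η (γ s)) (hγ.mono fun s hs => by
      exact (hasDerivAt_comp_curve hφ.contMDiff hs).differentiableAt.hasDerivAt)
    (hsmooth.derivWithin (m := 0) (by simp)).continuousAt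
    (hderiv _ hψ) (hγ.mono fun s hs => hη.minkowskiForm_deriv_add hφ hs)
    (by rw [hdφ.deriv]; exact hzero)
  simp only [hγ0] at hlittle
  refine hconv.2 γ hγ0 hγ.self_of_nhds hvel ?_
  refine isLittleO_distToHorosphere (g := φ ∘ γ) hsmooth.continuousAt
    (fun s => hφ.mem_hyperbolicSpace _) (hη.minkowskiForm_add_self hφ p) ?_ hlittle
  rw [Function.comp_apply, hγ0]
  exact hη.minkowskiForm_add_right hφ p

end Hypersurface

/-! ### The hyperbolic Gauss map. -/

section GaussMap

open Filter

variable {n : ℕ}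

/-- The spatial part `(x₁, …, x_{n+1})` of a vector of Minkowski space. -/
noncomputable def spatialPart (n : ℕ) : Minkowski n →L[ℝ] EuclideanSpace ℝ (Fin (n + 1)) :=
  LinearMap.toContinuousLinearMap
    { toFun := fun x => WithLp.toLp 2 fun i => x i.succ
      map_add' := fun _ _ => rfl
      map_smul' := fun _ _ => rfl }

@[simp]
lemma spatialPart_apply (x : Minkowski n) (i : Fin (n + 1)) : spatialPart n x i = x i.succ := rfl

lemma norm_spatialPart_of_null {ν : Minkowski n} (hν : minkowskiForm ν ν = 0) (h0 : 0 < ν 0) :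
    ‖spatialPart n ν‖ = ν 0 := by
  rw [EuclideanSpace.norm_eq]
  simp only [spatialPart_apply, Real.norm_eq_abs, sq_abs]
  rw [sum_succ_sq_of_null hν, Real.sqrt_sq h0.le]

/-- The central projection of the half-space `x₀ > 0` to the hyperplane `x₀ = 1`. -/
noncomputable def centralProjection (x : Minkowski n) : EuclideanSpace ℝ (Fin (n + 1)) :=
  (x 0)⁻¹ • spatialPart n x

lemma contDiffAt_centralProjection {x : Minkowski n} (hx : x 0 ≠ 0) :
    ContDiffAt ℝ ∞ (centralProjection (n := n)) x := by
  have h0 : ContDiffAt ℝ ∞ (fun y : Minkowski n => y 0) x :=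
    (EuclideanSpace.proj (𝕜 := ℝ) (0 : Fin (n + 2))).contDiff.contDiffAt
  exact (h0.inv hx).smul (spatialPart n).contDiff.contDiffAt

/-- The kernel of the differential of the central projection is the radial direction. -/
lemma eq_smul_of_fderiv_centralProjection_eq_zero {x w : Minkowski n} (hx : x 0 ≠ 0)
    (hw : fderiv ℝ (centralProjection (n := n)) x w = 0) : w = (w 0 / x 0) • x := by
  have h0 : HasFDerivAt (fun y : Minkowski n => y 0)
      (EuclideanSpace.proj (𝕜 := ℝ) (0 : Fin (n + 2))) x :=
    (EuclideanSpace.proj (𝕜 := ℝ) (0 : Fin (n + 2))).hasFDerivAt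
  have h1 := ((contDiffAt_centralProjection hx).differentiableAt (by simp)).hasFDerivAt
  -- Differentiating this identity where the differential of the projection kills `w` makes the
  -- spatial part of `w` equal to `w 0` times the projection of `x`.
  have h2 : (fun y : Minkowski n => y 0 • centralProjection y) =ᶠ[𝓝 x] spatialPart n := by
    filter_upwards [h0.continuousAt.eventually_ne hx] with y hy
    rw [centralProjection, smul_smul, mul_inv_cancel₀ hy, one_smul]
  have h3 := congrArg (fun L => L w)
    ((h0.smul h1).unique ((spatialPart n).hasFDerivAt.congr_of_eventuallyEq h2))
  simp only [add_apply, smul_apply,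
    ContinuousLinearMap.smulRight_apply, hw, smul_zero, zero_add, PiLp.proj_apply,
    centralProjection, smul_smul] at h3
  ext i
  refine Fin.cases ?_ (fun j => ?_) i
  · simp [hx]
  · have h4 := congrArg (fun u : EuclideanSpace ℝ (Fin (n + 1)) => u j) h3
    simp only [PiLp.smul_apply, spatialPart_apply, smul_eq_mul] at h4
    simp [← h4, div_eq_mul_inv]

variable {M : Type*} [TopologicalSpace M] [ChartedSpace (EuclideanSpace ℝ (Fin n)) M]
  {φ η : M → Minkowski n}

/-- The hyperbolic Gauss map `p ↦ (φ + η)(p)_space / (φ + η)(p)₀`, sending a point to the point at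
infinity of its tangent horosphere. -/
noncomputable def hyperbolicGaussMap (hφ : IsImmersedHypersurface φ) (hη : IsUnitNormal φ η) :
    M → Metric.sphere (0 : EuclideanSpace ℝ (Fin (n + 1))) 1 :=
  Set.codRestrict (fun p => centralProjection (φ p + η p)) _ fun p => by
    have h0 := hη.zero_coord_add_pos hφ p
    rw [mem_sphere_zero_iff_norm, centralProjection, norm_smul, norm_inv,
      norm_spatialPart_of_null (hη.minkowskiForm_add_self hφ p) h0, Real.norm_of_nonneg h0.le,
      inv_mul_cancel₀ h0.ne']

lemma contMDiff_centralProjection_add (hφ : IsImmersedHypersurface φ) (hη : IsUnitNormal φ η) :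
    ContMDiff (𝓡 n) 𝓘(ℝ, EuclideanSpace ℝ (Fin (n + 1))) ∞
      (fun p => centralProjection (φ p + η p)) := fun p =>
  ContMDiffAt.comp p (g := centralProjection) (f := fun p => φ p + η p)
    (contDiffAt_centralProjection (hη.zero_coord_add_pos hφ p).ne').contMDiffAt
    (hφ.contMDiff.add hη.contMDiff).contMDiffAt

variable [IsManifold (𝓡 n) ∞ M]

lemma contMDiff_hyperbolicGaussMap (hφ : IsImmersedHypersurface φ) (hη : IsUnitNormal φ η) :
    ContMDiff (𝓡 n) (𝓡 n) ∞ (hyperbolicGaussMap hφ hη) := by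
  have : Fact (Module.finrank ℝ (EuclideanSpace ℝ (Fin (n + 1))) = n + 1) :=
    ⟨finrank_euclideanSpace_fin⟩
  exact (contMDiff_centralProjection_add hφ hη).codRestrict_sphere _

/-- Pairing with `dφ(v)` separates the two sides: it kills `φ p + η p`, but by convexity not the
derivative. Arbitrary `r` serves the Gauss map; `r = 0` serves `φ + η` itself. -/
lemma mfderiv_add_ne_smul (hφ : IsImmersedHypersurface φ) (hη : IsUnitNormal φ η)
    (hconv : ∀ p, IsHorosphericallyConvexAt φ η p) {p : M} {v : EuclideanSpace ℝ (Fin n)}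
    (hv : v ≠ 0) (r : ℝ) :
    (mfderiv (𝓡 n) 𝓘(ℝ, Minkowski n) (fun q => φ q + η q) p v : Minkowski n) ≠
      r • (φ p + η p) := by
  have h1 := (hconv p).minkowskiForm_mfderiv_ne_zero hφ hη hv
  have h2 := hη.minkowskiForm_mfderiv_add hφ p v
  intro h
  refine h1 ((congrArg _ h).trans ((minkowskiForm_smul_right r _ _).trans ?_))
  exact mul_eq_zero_of_right r h2

lemma injective_mfderiv_hyperbolicGaussMap (hφ : IsImmersedHypersurface φ)
    (hη : IsUnitNormal φ η) (hconv : ∀ p, IsHorosphericallyConvexAt φ η p) (p : M) :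
    Function.Injective (mfderiv (𝓡 n) (𝓡 n) (hyperbolicGaussMap hφ hη) p) := by
  have : Fact (Module.finrank ℝ (EuclideanSpace ℝ (Fin (n + 1))) = n + 1) :=
    ⟨finrank_euclideanSpace_fin⟩
  rw [injective_iff_map_eq_zero]
  intro v hv
  by_contra hv0
  have hψ : ContMDiff (𝓡 n) 𝓘(ℝ, Minkowski n) ∞ (fun q => φ q + η q) :=
    hφ.contMDiff.add hη.contMDiff
  have hx : (φ p + η p) 0 ≠ 0 := (hη.zero_coord_add_pos hφ p).ne'
  have h1 := ((contMDiff_coe_sphere (m := ∞)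
    (hyperbolicGaussMap hφ hη p)).mdifferentiableAt (by simp)).hasMFDerivAt.comp p
    ((contMDiff_hyperbolicGaussMap hφ hη p).mdifferentiableAt (by simp)).hasMFDerivAt
  have h2 := HasMFDerivAt.comp p (g := centralProjection (n := n))
    ((contDiffAt_centralProjection hx).differentiableAt (by simp)).hasFDerivAt.hasMFDerivAt
    ((hψ p).mdifferentiableAt (by simp)).hasMFDerivAt
  have h3 := congrArg (fun L => L v) (hasMFDerivAt_unique h1 h2)
  have h4 : fderiv ℝ (centralProjection (n := n)) (φ p + η p)
      (mfderiv (𝓡 n) 𝓘(ℝ, Minkowski n) (fun q => φ q + η q) p v : Minkowski n) = 0 := by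
    refine h3.symm.trans ?_
    rw [ContinuousLinearMap.comp_apply, hv, map_zero]
    rfl
  have h5 := eq_smul_of_fderiv_centralProjection_eq_zero hx h4
  exact mfderiv_add_ne_smul hφ hη hconv hv0 _ h5

lemma injective_mfderiv_add (hφ : IsImmersedHypersurface φ)
    (hη : IsUnitNormal φ η) (hconv : ∀ p, IsHorosphericallyConvexAt φ η p) (p : M) :
    Function.Injective (mfderiv (𝓡 n) 𝓘(ℝ, Minkowski n) (fun q => φ q + η q) p) := by
  rw [injective_iff_map_eq_zero]
  intro v hv
  by_contra hv0
  exact mfderiv_add_ne_smul hφ hη hconv hv0 0 (hv.trans (zero_smul ℝ (φ p + η p)).symm)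

end GaussMap

/-! ### Large-time leaves as perturbations of `φ + η`. -/

lemma normalFlow_eq_smul {n : ℕ} {M : Type*} (φ η : M → Minkowski n) (t : ℝ) (p : M) :
    normalFlow φ η t p =
      (Real.exp t / 2) • ((φ p + η p) + Real.exp (-2 * t) • (φ p - η p)) := by
  have h : Real.exp t * Real.exp (-2 * t) = Real.exp (-t) := by
    rw [← Real.exp_add]
    ring_nf
  rw [normalFlow, Real.cosh_eq, Real.sinh_eq, ← h]
  module

theorem corollary3p2 {n : ℕ} (hn : 2 ≤ n)
    {M : Type*} [TopologicalSpace M] [T2Space M] [CompactSpace M] [ConnectedSpace M]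
    [ChartedSpace (EuclideanSpace ℝ (Fin n)) M] [IsManifold (𝓡 n) ∞ M]
    (φ η : M → Minkowski n)
    (hφ : IsImmersedHypersurface φ) (hη : IsUnitNormal φ η)
    (hconv : ∀ p, IsHorosphericallyConvexAt φ η p) :
    ∃ t₀ : ℝ, ∀ t : ℝ, t₀ ≤ t → IsEmbeddedSphere (normalFlow φ η t) := by
  obtain ⟨Φ, hΦ⟩ := (contMDiff_hyperbolicGaussMap hφ hη).exists_diffeomorph_sphere hn
    (injective_mfderiv_hyperbolicGaussMap hφ hη hconv)
  have hψ : ContMDiff (𝓡 n) 𝓘(ℝ, Minkowski n) ∞ (fun q => φ q + η q) :=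
    hφ.contMDiff.add hη.contMDiff
  have hχ : ContMDiff (𝓡 n) 𝓘(ℝ, Minkowski n) ∞ (fun q => φ q - η q) :=
    hφ.contMDiff.sub hη.contMDiff
  -- The Gauss map depends on `p` only through `φ p + η p`, so its injectivity passes to `φ + η`.
  have hψinj : Function.Injective (fun q => φ q + η q) := by
    intro p q hpq
    have hG : hyperbolicGaussMap hφ hη p = hyperbolicGaussMap hφ hη q :=
      Subtype.ext (congrArg centralProjection hpq)
    rw [← hΦ] at hG
    exact Φ.injective hG
  have hlim : Filter.Tendsto (fun t : ℝ => Real.exp (-2 * t)) Filter.atTop (𝓝 0) :=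
    Real.tendsto_exp_atBot.comp (Filter.tendsto_id.const_mul_atTop_of_neg (by norm_num))
  obtain ⟨t₀, ht₀⟩ := Filter.eventually_atTop.1 (hlim.eventually
    (eventually_injective_immersion_add_smul hψ hχ hψinj (injective_mfderiv_add hφ hη hconv)))
  refine ⟨t₀, fun t ht => ?_⟩
  obtain ⟨hinj, himm⟩ := ht₀ t ht
  have hc : Real.exp t / 2 ≠ 0 := by positivity
  have hflow : normalFlow φ η t = fun p =>
      (Real.exp t / 2) • ((φ p + η p) + Real.exp (-2 * t) • (φ p - η p)) :=
    funext (normalFlow_eq_smul φ η t)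
  have hF : ContMDiff (𝓡 n) 𝓘(ℝ, Minkowski n) ∞
      (fun p => (φ p + η p) + Real.exp (-2 * t) • (φ p - η p)) :=
    hψ.add ((contDiff_const_smul (Real.exp (-2 * t))).contMDiff.comp hχ)
  have hsmooth : ContMDiff (𝓡 n) 𝓘(ℝ, Minkowski n) ∞ (normalFlow φ η t) := by
    rw [hflow]
    exact (contDiff_const_smul (Real.exp t / 2)).contMDiff.comp hF
  refine ⟨⟨hη.normalFlow_mem_hyperbolicSpace hφ t, hsmooth, fun p => ?_⟩, ?_, ⟨Φ⟩⟩
  · have h1 := ((hF p).mdifferentiableAt (by simp)).hasMFDerivAt.const_smul (Real.exp t / 2)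
    rw [hflow]
    have h2 := h1.mfderiv
    intro v w hvw
    apply himm p
    have h3 := congrArg (fun L => L v) h2
    have h4 := congrArg (fun L => L w) h2
    exact smul_right_injective _ hc (h3.symm.trans (hvw.trans h4))
  · refine (hsmooth.continuous.isClosedEmbedding ?_).isEmbedding
    rw [hflow]
    exact (smul_right_injective _ hc).comp hinj
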